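/- Let $V$ be a finite set, let $s,t\in V$ with $s\neq t$, and let $E$ be the edge set of the complete graph on $V$. For $U\subseteq V$ let $\delta(U)\subseteq E$ be the set of edges with exactly one endpoint in $U$, write $\delta(v):=\delta(\{v\})$, and for $x\in\mathbb{R}^E$ and $F\subseteq E$ write $x(F):=\sum_{e\in F}x_e$ and let $\chi^F\in\{0,1\}^E$ be the characteristic vector of $F$. Let $\mathcal{S}$ be the set of edge sets of spanning trees of $(V,E)$. Let $x^*\in\mathbb{R}^E$ be a feasible solution of the $s$-$t$-path TSP linear program, that is, $$\begin{array}{ll} x^*(\delta(U))\ge 2 & (\emptyset\ne U\subsetneq V,\ |U\cap\{s,t\}|\text{ even}),\\ x^*(\delta(U))\ge 1 & (\emptyset\ne U\subsetneq V,\ |U\cap\{s,t\}|\text{ odd}),\\ x^*(\delta(v))=2 & (v\in V\setminus\{s,t\}),\\ x^*(\delta(v))=1 & (v\in\{s,t\}),\\ x^*_e\ge 0 & (e\in E). \end{array}$$ Call $C\subseteq E$ a narrow cut if $C=\delta(U)$ for some $\emptyset\ne U\subsetneq V$ and $x^*(C)<2$, and let $\mathcal{C}$ be the set of narrow cuts.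 Then there are $r\in\mathbb{N}$, $S_1,\dots,S_r\in\mathcal{S}$ and real numbers $p_1,\dots,p_r>0$ with $\sum_{j=1}^r p_j=1$ such that $x^*=\sum_{j=1}^r p_j\chi^{S_j}$ and for every $C\in\mathcal{C}$ there exists $k\in\{1,\dots,r\}$ with $\sum_{j=1}^k p_j\ge 2-x^*(C)$ and $|C\cap S_j|=1$ for all $j=1,\dots,k$. In particular, there is a global Gao tree in the support of $x^*$, i.e. an $S\in\mathcal{S}$ with $x^*_e>0$ for all $e\in S$ and $|C\cap S|=1$ for all $C\in\mathcal{C}$. -/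

import Mathlib

namespace PathTSP

/-- The edge set `E` of the complete graph on `V`. -/
abbrev Edge (V : Type*) : Type _ := {e : Sym2 V // ¬ e.IsDiag}

variable {V : Type*} [Fintype V] [DecidableEq V]

/-- `δ(U)`: the edges with exactly one endpoint in `U`. -/
def cut (U : Finset V) : Finset (Edge V) :=
  Finset.univ.filter fun e => ∃ u v : V, u ∈ U ∧ v ∉ U ∧ e.1 = s(u, v)

/-- `x(F) = ∑_{e ∈ F} x_e`. -/
def weight (x : Edge V → ℝ) (F : Finset (Edge V)) : ℝ :=
  ∑ e ∈ F, x e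

/-- The characteristic vector `χ^F ∈ {0,1}^E`. -/
def chi (F : Finset (Edge V)) : Edge V → ℝ :=
  fun e => if e ∈ F then 1 else 0

/-- Feasible solutions of the natural LP relaxation of the `s`-`t`-path TSP. -/
structure IsFeasible (s t : V) (x : Edge V → ℝ) : Prop where
  even_cut : ∀ U : Finset V, U.Nonempty → U ≠ Finset.univ →
    Even (U ∩ {s, t}).card → 2 ≤ weight x (cut U)
  odd_cut : ∀ U : Finset V, U.Nonempty → U ≠ Finset.univ →
    Odd (U ∩ {s, t}).card → 1 ≤ weight x (cut U)
  degree_inner : ∀ v : V, v ≠ s → v ≠ t → weight x (cut {v}) = 2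
  degree_left : weight x (cut {s}) = 1
  degree_right : weight x (cut {t}) = 1
  nonneg : ∀ e : Edge V, 0 ≤ x e

/-- `S` is the edge set of a spanning tree of the complete graph on `V`. -/
def IsSpanningTree (S : Finset (Edge V)) : Prop :=
  (SimpleGraph.fromEdgeSet {e : Sym2 V | ∃ f ∈ S, f.1 = e}).IsTree

/-- The narrow cuts of `x`: cuts `C = δ(U)`, `∅ ≠ U ⊂ V`, with `x(C) < 2`. -/
def narrowCuts (x : Edge V → ℝ) : Set (Finset (Edge V)) :=
  {C | (∃ U : Finset V, U.Nonempty ∧ U ≠ Finset.univ ∧ C = cut U) ∧ weight x C < 2}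

/-- `S` is a local Gao tree at the cut `C`. -/
def IsLocalGaoTree (C S : Finset (Edge V)) : Prop :=
  IsSpanningTree S ∧ (C ∩ S).card = 1

/-- `S` is a global Gao tree for `x`: a spanning tree that is a local Gao tree at every
narrow cut of `x`. -/
def IsGlobalGaoTree (x : Edge V → ℝ) (S : Finset (Edge V)) : Prop :=
  IsSpanningTree S ∧ ∀ C ∈ narrowCuts x, IsLocalGaoTree C S

end PathTSP

/-! Edmonds' description makes every feasible `x` a point of the spanning tree polytope, and the
narrow cuts are the cuts `δ(L)` of a chain of sets `L ∋ s`, with slack `(x(δ(L)) - 1) / 2` in the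
rank constraints at `L` and at its complement.

Let `y` be a multiple `σ > 0` of a point of the polytope, and consider a chain of sets for which
these slacks are below `σ / 2`. Among the spanning trees in the minimal face containing `y`, let `S`
be one in which no edge `e` can be exchanged for an edge of the support that lies in the smallest
tight set around `e` and crosses fewer members of the chain; Kruskal's algorithm provides such a
tree. Uncrossing shows that every edge of `S` crosses at most one member of the chain, and then that
every member is crossed by exactly one edge of `S`.

Subtracting the largest multiple of `χ^S` that keeps the remainder in the cone over the polytope
makes a further inequality tight, so this ends after finitely many steps. Since `S` is tight at the
members of the chain and at their complements, the slacks there never change: the member `L` stays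
in the chain until the remaining scale has dropped to `x(δ(L)) - 1`, that is, for a prefix of the
trees of total weight at least `2 - x(δ(L))`.
-/

namespace PathTSP

open Finset
open scoped symmDiff

section Preliminaries

theorem card_inter_pair {α : Type*} [DecidableEq α] {s t : α} (hst : s ≠ t) (A : Finset α) :
    #(A ∩ {s, t}) = (if s ∈ A then 1 else 0) + (if t ∈ A then 1 else 0) := by
  rw [inter_comm, ← filter_mem_eq_inter, card_filter, sum_pair hst]

theorem exists_max_step {ι : Type*} [Finite ι] {a b : ι → ℝ} (ha : ∀ i, 0 ≤ a i)
    (hab : ∀ i, 0 < b i → 0 < a i) (hb : ∃ i, 0 < b i) :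
    ∃ ε > 0, (∀ i, ε * b i ≤ a i) ∧ ∃ i, 0 < a i ∧ ε * b i = a i := by
  classical
  cases nonempty_fintype ι
  obtain ⟨j, hj⟩ := hb
  obtain ⟨i, hi, hmin⟩ := exists_min_image (univ.filter (0 < b ·)) (fun i => a i / b i)
    ⟨j, by simpa using hj⟩
  simp only [mem_filter, mem_univ, true_and] at hi hmin
  have hpos : 0 < a i / b i := div_pos (hab i hi) hi
  refine ⟨a i / b i, hpos, fun k => ?_, i, hab i hi, div_mul_cancel₀ _ hi.ne'⟩
  rcases le_or_gt (b k) 0 with hk | hk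
  · exact (mul_nonpos_of_nonneg_of_nonpos hpos.le hk).trans (ha k)
  · exact (le_div_iff₀ hk).1 (hmin k hk)

theorem sum_Iio_succ_cons {r : ℕ} (c : ℝ) (p : Fin r → ℝ) (j : Fin r) :
    ∑ i ∈ Iio j.succ, (Fin.cons c p : Fin (r + 1) → ℝ) i = c + ∑ i ∈ Iio j, p i := by
  simp [← filter_gt_eq_Iio, sum_filter, Fin.sum_univ_succ]

theorem exists_sum_Iio_lt_le_sum_Iic {ι : Type*} [Fintype ι] [LinearOrder ι]
    [LocallyFiniteOrderBot ι] {p : ι → ℝ} {T : ℝ} (hT : 0 < T) (hle : T ≤ ∑ i, p i) :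
    ∃ k, ∑ i ∈ Iio k, p i < T ∧ T ≤ ∑ i ∈ Iic k, p i := by
  have hlower {s : Finset ι} (hs : IsLowerSet (s : Set ι)) (hsT : T ≤ ∑ i ∈ s, p i) :
      ∃ m ∈ s, T ≤ ∑ i ∈ Iic m, p i := by
    obtain ⟨m, hm, hmax⟩ := exists_max_image s id
      (nonempty_of_sum_ne_zero (hT.trans_le hsT).ne')
    have hIic : Iic m = s := by
      ext i
      exact mem_Iic.trans ⟨fun hi => hs hi hm, fun hi => hmax i hi⟩
    exact ⟨m, hm, hIic ▸ hsT⟩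
  obtain ⟨m, -, hm⟩ := hlower (s := univ) (by simp [isLowerSet_univ]) hle
  obtain ⟨k, hk⟩ := exists_minimal (s := univ.filter fun k => T ≤ ∑ i ∈ Iic k, p i)
    ⟨m, by simpa using hm⟩
  refine ⟨k, lt_of_not_ge fun hTk => ?_, (mem_filter.1 hk.prop).2⟩
  obtain ⟨j, hj, hTj⟩ := hlower (by simpa using isLowerSet_Iio k) hTk
  exact (mem_Iio.1 hj).not_ge (hk.le_of_le (by simpa using hTj) (mem_Iio.1 hj).le)

end Preliminaries

section Edge

variable {V : Type*}

theorem Edge.exists_eq (e : Edge V) : ∃ (u v : V) (h : ¬ s(u, v).IsDiag), e = ⟨s(u, v), h⟩ := by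
  obtain ⟨e, he⟩ := e
  induction e using Sym2.ind with
  | _ u v => exact ⟨u, v, he, rfl⟩

theorem weight_nonneg {y : Edge V → ℝ} (hy : ∀ e, 0 ≤ y e) (F : Finset (Edge V)) :
    0 ≤ weight y F :=
  sum_nonneg fun e _ => hy e

theorem weight_mono {y : Edge V → ℝ} (hy : ∀ e, 0 ≤ y e) {F G : Finset (Edge V)} (h : F ⊆ G) :
    weight y F ≤ weight y G :=
  sum_le_sum_of_subset_of_nonneg h fun e _ _ => hy e

theorem weight_mul_le_mul_weight {y t : Edge V → ℝ} (hy : ∀ e, 0 ≤ y e) {c : ℝ}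
    {F : Finset (Edge V)} (h : ∀ e ∈ F, 0 < y e → t e ≤ c) :
    weight (t * y) F ≤ c * weight y F := by
  rw [weight, weight, mul_sum]
  refine sum_le_sum fun e he => ?_
  rcases (hy e).eq_or_lt with hzero | hpos
  · simp [← hzero]
  · exact mul_le_mul_of_nonneg_right (h e he hpos) hpos.le

theorem weight_sub_smul (y z : Edge V → ℝ) (c : ℝ) (F : Finset (Edge V)) :
    weight (y - c • z) F = weight y F - c * weight z F := by
  simp [weight, sum_sub_distrib, mul_sum]

theorem exists_pos_of_weight_pos {y : Edge V → ℝ} {F : Finset (Edge V)} (h : 0 < weight y F) :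
    ∃ e ∈ F, 0 < y e :=
  exists_lt_of_sum_lt (by simpa [weight] using h)

theorem weight_eq_sum_ite [Fintype V] [DecidableEq V] (y : Edge V → ℝ) (F : Finset (Edge V)) :
    weight y F = ∑ e, if e ∈ F then y e else 0 := by
  simp [weight]

theorem weight_mul_chi [DecidableEq V] (z : Edge V → ℝ) (S F : Finset (Edge V)) :
    weight (z * chi S) F = weight z (S ∩ F) := by
  simp [weight, chi, sum_ite_mem, inter_comm]

theorem weight_chi [DecidableEq V] (S F : Finset (Edge V)) :
    weight (chi S) F = (#(S ∩ F) : ℝ) := by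
  simpa [weight] using weight_mul_chi 1 S F

theorem chi_nonneg [DecidableEq V] (S : Finset (Edge V)) (e : Edge V) : 0 ≤ chi S e := by
  unfold chi
  positivity

theorem chi_pos_iff [DecidableEq V] {S : Finset (Edge V)} {e : Edge V} :
    0 < chi S e ↔ e ∈ S := by
  unfold chi
  split_ifs <;> simp_all

theorem sum_smul_chi_pos [DecidableEq V] {ι : Type*} [Fintype ι] {S : ι → Finset (Edge V)}
    {p : ι → ℝ} (hp : ∀ j, 0 ≤ p j) {j : ι} (hj : 0 < p j) {e : Edge V} (he : e ∈ S j) :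
    0 < (∑ j, p j • chi (S j)) e := by
  rw [Finset.sum_apply]
  exact sum_pos' (fun i _ => mul_nonneg (hp i) (chi_nonneg _ e))
    ⟨j, mem_univ j, mul_pos hj (chi_pos_iff.2 he)⟩

/-- The graph on `V` with edge set `S`. -/
def graph (S : Finset (Edge V)) : SimpleGraph V :=
  SimpleGraph.fromEdgeSet {e : Sym2 V | ∃ f ∈ S, f.1 = e}

theorem graph_adj {S : Finset (Edge V)} {u v : V} :
    (graph S).Adj u v ↔ ∃ h, (⟨s(u, v), h⟩ : Edge V) ∈ S := by
  simp [graph]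

theorem IsSpanningTree.card_add_one [Fintype V] {S : Finset (Edge V)} (hS : IsSpanningTree S) :
    #S + 1 = Fintype.card V := by
  have hedge : (graph S).edgeSet = Subtype.val '' (S : Set (Edge V)) := by
    ext e
    induction e using Sym2.ind with
    | _ u v => simp [graph_adj]
  have h : Nat.card (graph S).edgeSet + 1 = Nat.card V :=
    (SimpleGraph.isTree_iff_connected_and_card.1 hS).2
  rwa [hedge, Nat.card_image_of_injective Subtype.val_injective, SetLike.coe_sort_coe,
    Nat.card_eq_finsetCard, Nat.card_eq_fintype_card] at h

end Edge

variable {V : Type*} [Fintype V] [DecidableEq V]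

theorem mem_cut {U : Finset V} {u v : V} {h : ¬ s(u, v).IsDiag} :
    (⟨s(u, v), h⟩ : Edge V) ∈ cut U ↔ ¬ (u ∈ U ↔ v ∈ U) := by
  simp only [cut, mem_filter, mem_univ, true_and, Sym2.eq_iff]
  constructor
  · rintro ⟨a, b, ha, hb, ⟨rfl, rfl⟩ | ⟨rfl, rfl⟩⟩ <;> tauto
  · intro h
    by_cases hu : u ∈ U
    · exact ⟨u, v, hu, by tauto, .inl ⟨rfl, rfl⟩⟩
    · exact ⟨v, u, by tauto, hu, .inr ⟨rfl, rfl⟩⟩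

theorem exists_eq_of_mem_cut {U : Finset V} {e : Edge V} (he : e ∈ cut U) :
    ∃ u ∈ U, ∃ v ∉ U, ∃ h, e = ⟨s(u, v), h⟩ := by
  obtain ⟨e, hdiag⟩ := e
  obtain ⟨u, v, hu, hv, rfl⟩ := (mem_filter.1 he).2
  exact ⟨u, hu, v, hv, hdiag, rfl⟩

theorem cut_compl (U : Finset V) : cut Uᶜ = cut U := by
  ext e
  obtain ⟨u, v, huv, rfl⟩ := e.exists_eq
  simp only [mem_cut, mem_compl]
  tauto

theorem cut_univ : cut (univ : Finset V) = ∅ := by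
  ext e
  obtain ⟨u, v, huv, rfl⟩ := e.exists_eq
  simp [mem_cut]

theorem cut_symmDiff (X Y : Finset V) : cut (X ∆ Y) = cut X ∆ cut Y := by
  ext e
  obtain ⟨u, v, huv, rfl⟩ := e.exists_eq
  simp only [mem_cut, mem_symmDiff]
  tauto

/-- The edges with both endpoints in `A`. -/
def inside (A : Finset V) : Finset (Edge V) :=
  univ.filter fun e => ∀ v ∈ e.1, v ∈ A

/-- The edges with one endpoint in `X` and the other in `Y`. -/
def between (X Y : Finset V) : Finset (Edge V) :=
  univ.filter fun e => ∃ u v : V, u ∈ X ∧ v ∈ Y ∧ e.1 = s(u, v)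

theorem mem_inside {A : Finset V} {u v : V} {h : ¬ s(u, v).IsDiag} :
    (⟨s(u, v), h⟩ : Edge V) ∈ inside A ↔ u ∈ A ∧ v ∈ A := by
  simp [inside]

theorem mem_between {X Y : Finset V} {u v : V} {h : ¬ s(u, v).IsDiag} :
    (⟨s(u, v), h⟩ : Edge V) ∈ between X Y ↔ (u ∈ X ∧ v ∈ Y) ∨ (v ∈ X ∧ u ∈ Y) := by
  simp only [between, mem_filter, mem_univ, true_and, Sym2.eq_iff]
  constructor
  · rintro ⟨a, b, ha, hb, ⟨rfl, rfl⟩ | ⟨rfl, rfl⟩⟩ <;> tauto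
  · rintro (⟨ha, hb⟩ | ⟨ha, hb⟩)
    · exact ⟨u, v, ha, hb, .inl ⟨rfl, rfl⟩⟩
    · exact ⟨v, u, ha, hb, .inr ⟨rfl, rfl⟩⟩

theorem inside_mono {A B : Finset V} (h : A ⊆ B) : inside A ⊆ inside B := by
  intro e he
  obtain ⟨u, v, huv, rfl⟩ := e.exists_eq
  rw [mem_inside] at he ⊢
  exact ⟨h he.1, h he.2⟩

theorem inside_singleton (v : V) : inside {v} = ∅ := by
  ext e
  obtain ⟨a, b, hab, rfl⟩ := e.exists_eq
  simp only [mem_inside, mem_singleton, notMem_empty, iff_false]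
  rintro ⟨rfl, rfl⟩
  exact hab rfl

theorem inside_univ : inside (univ : Finset V) = univ := by
  simp [inside]

theorem inside_inter (A B : Finset V) : inside (A ∩ B) = inside A ∩ inside B := by
  ext e
  obtain ⟨u, v, huv, rfl⟩ := e.exists_eq
  simp only [mem_inside, mem_inter]
  tauto

theorem nonempty_of_mem_inside_inter_cut {A X : Finset V} {e : Edge V}
    (he : e ∈ inside A ∩ cut X) : (A ∩ X).Nonempty ∧ (A \ X).Nonempty := by
  obtain ⟨u, v, huv, rfl⟩ := e.exists_eq
  rw [mem_inter, mem_inside, mem_cut] at he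
  obtain ⟨⟨hu, hv⟩, h⟩ := he
  by_cases hX : u ∈ X
  · exact ⟨⟨u, by simp [*]⟩, ⟨v, by simp_all⟩⟩
  · exact ⟨⟨v, by simp_all⟩, ⟨u, by simp [*]⟩⟩

theorem weight_inside_split (y : Edge V → ℝ) (A X : Finset V) :
    weight y (inside A) = weight y (inside (A ∩ X)) + weight y (inside (A \ X)) +
      weight y (inside A ∩ cut X) := by
  simp only [weight_eq_sum_ite, ← sum_add_distrib]
  refine sum_congr rfl fun e _ => ?_
  obtain ⟨u, v, huv, rfl⟩ := e.exists_eq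
  simp only [mem_inside, mem_cut, mem_inter, mem_sdiff]
  by_cases u ∈ A <;> by_cases u ∈ X <;> by_cases v ∈ A <;> by_cases v ∈ X <;> simp [*]

theorem inter_inside_inter_cut {A X : Finset V} {S : Finset (Edge V)} {e : Edge V}
    (hX : S ∩ cut X = {e}) (he : e ∈ inside A) : S ∩ (inside A ∩ cut X) = {e} := by
  rw [inter_left_comm, hX, inter_singleton_of_mem he]

/-- The slack of the rank constraint at `A` of the spanning tree polytope scaled by `σ`. -/
def gap (y : Edge V → ℝ) (σ : ℝ) (A : Finset V) : ℝ :=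
  σ * ((#A : ℝ) - 1) - weight y (inside A)

theorem gap_sub_smul (y z : Edge V → ℝ) (σ τ c : ℝ) (A : Finset V) :
    gap (y - c • z) (σ - c * τ) A = gap y σ A - c * gap z τ A := by
  simp only [gap, weight_sub_smul]
  ring

theorem gap_uncross (y : Edge V → ℝ) (σ : ℝ) (A B : Finset V) :
    gap y σ A + gap y σ B =
      gap y σ (A ∩ B) + gap y σ (A ∪ B) + weight y (between (A \ B) (B \ A)) := by
  have hweight : weight y (inside A) + weight y (inside B) + weight y (between (A \ B) (B \ A)) =
      weight y (inside (A ∩ B)) + weight y (inside (A ∪ B)) := by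
    simp only [weight_eq_sum_ite, ← sum_add_distrib]
    refine sum_congr rfl fun e _ => ?_
    obtain ⟨u, v, huv, rfl⟩ := e.exists_eq
    simp only [mem_inside, mem_between, mem_inter, mem_union, mem_sdiff]
    by_cases u ∈ A <;> by_cases u ∈ B <;> by_cases v ∈ A <;> by_cases v ∈ B <;> simp [*]
  have hcard : (#(A ∪ B) : ℝ) + #(A ∩ B) = #A + #B := by
    exact_mod_cast card_union_add_card_inter A B
  unfold gap
  linear_combination -σ * hcard - hweight

theorem gap_split (y : Edge V → ℝ) (σ : ℝ) (A X : Finset V) :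
    gap y σ (A ∩ X) + gap y σ (A \ X) + σ = gap y σ A + weight y (inside A ∩ cut X) := by
  have hweight := weight_inside_split y A X
  have hcard : (#(A ∩ X) : ℝ) + #(A \ X) = #A := by
    exact_mod_cast card_inter_add_card_sdiff A X
  unfold gap
  linear_combination σ * hcard + hweight

/-- `σ` times the spanning tree polytope, in Edmonds' description by rank inequalities. -/
structure InCone (y : Edge V → ℝ) (σ : ℝ) : Prop where
  nonneg : ∀ e, 0 ≤ y e
  gap_nonneg : ∀ A : Finset V, A.Nonempty → 0 ≤ gap y σ A
  gap_univ : gap y σ univ = 0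

/-- The rank constraint at `A` holds with equality for `y`. -/
def IsTight (y : Edge V → ℝ) (σ : ℝ) (A : Finset V) : Prop :=
  A.Nonempty ∧ gap y σ A = 0

section InCone

variable {y : Edge V → ℝ} {σ : ℝ} {A B X : Finset V}

theorem InCone.isTight_univ [Nonempty V] (hy : InCone y σ) : IsTight y σ univ :=
  ⟨univ_nonempty, hy.gap_univ⟩

theorem InCone.gap_inter_le (hy : InCone y σ) (hA : IsTight y σ A) :
    gap y σ (A ∩ B) ≤ gap y σ B := by
  linarith [gap_uncross y σ A B, hy.gap_nonneg (A ∪ B) (hA.1.mono subset_union_left),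
    weight_nonneg hy.nonneg (between (A \ B) (B \ A)), hA.2]

theorem InCone.isTight_inter (hy : InCone y σ) (hA : IsTight y σ A) (hB : IsTight y σ B)
    (hAB : (A ∩ B).Nonempty) : IsTight y σ (A ∩ B) :=
  ⟨hAB, le_antisymm ((hy.gap_inter_le hA).trans_eq hB.2) (hy.gap_nonneg _ hAB)⟩

theorem InCone.sub_gap_le_weight (hy : InCone y σ) (h1 : (A ∩ X).Nonempty)
    (h2 : (A \ X).Nonempty) : σ - gap y σ A ≤ weight y (inside A ∩ cut X) := by
  linarith [gap_split y σ A X, hy.gap_nonneg _ h1, hy.gap_nonneg _ h2]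

theorem InCone.exists_mem_inside_inter_cut (hy : InCone y σ) (hA : gap y σ A < σ)
    (h1 : (A ∩ X).Nonempty) (h2 : (A \ X).Nonempty) : ∃ e ∈ inside A ∩ cut X, 0 < y e :=
  exists_pos_of_weight_pos ((sub_pos.2 hA).trans_le (hy.sub_gap_le_weight h1 h2))

end InCone

section Tree

/-- Acyclic edge sets, characterised by fundamental cuts: every edge is the only one in some
cut. -/
def IsForest (S : Finset (Edge V)) : Prop :=
  ∀ e ∈ S, ∃ X, S ∩ cut X = {e}

variable {S : Finset (Edge V)}

theorem graph_reachable_iff {u v : V} :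
    (graph S).Reachable u v ↔ ∀ X : Finset V, ¬ (u ∈ X ↔ v ∈ X) → (S ∩ cut X).Nonempty := by
  classical
  constructor
  · rintro ⟨p⟩ X hX
    have hX' : ∃ Y : Finset V, u ∈ Y ∧ v ∉ Y ∧ cut Y = cut X := by
      by_cases hu : u ∈ X
      · exact ⟨X, hu, by tauto, rfl⟩
      · exact ⟨Xᶜ, by simpa, by simp; tauto, cut_compl X⟩
    obtain ⟨Y, hu, hv, hY⟩ := hX'
    obtain ⟨d, -, hd⟩ := p.exists_boundary_dart (Y : Set V) (by simpa) (by simpa)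
    obtain ⟨h, hS⟩ := graph_adj.1 d.adj
    exact ⟨_, mem_inter.2 ⟨hS, by rw [← hY, mem_cut]; simp_all⟩⟩
  · intro h
    by_contra huv
    obtain ⟨e, he⟩ := h (univ.filter ((graph S).Reachable u)) (by simpa)
    obtain ⟨a, b, hab, rfl⟩ := e.exists_eq
    rw [mem_inter, mem_cut] at he
    have hadj : (graph S).Reachable a b := (graph_adj.2 ⟨hab, he.1⟩).reachable
    simp only [mem_filter, mem_univ, true_and] at he
    exact he.2 ⟨fun h => h.trans hadj, fun h => h.trans hadj.symm⟩

theorem graph_isAcyclic_iff : (graph S).IsAcyclic ↔ IsForest S := by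
  have hdelete (e : Edge V) : (graph S).deleteEdges {e.1} = graph (S.erase e) := by
    ext u v
    obtain ⟨a, b, hab, rfl⟩ := e.exists_eq
    simp only [SimpleGraph.deleteEdges_adj, graph_adj, Set.mem_singleton_iff, mem_erase, ne_eq,
      Subtype.mk.injEq]
    tauto
  have hcut (e : Edge V) (he : e ∈ S) (X : Finset V) :
      S ∩ cut X = {e} ↔ e ∈ cut X ∧ ¬ (S.erase e ∩ cut X).Nonempty := by
    rw [not_nonempty_iff_eq_empty]
    simp only [Finset.ext_iff, mem_inter, mem_singleton, mem_erase, notMem_empty, iff_false]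
    grind
  simp only [SimpleGraph.isAcyclic_iff_forall_adj_isBridge, SimpleGraph.isBridge_iff]
  constructor
  · intro h e he
    obtain ⟨u, v, huv, rfl⟩ := e.exists_eq
    have := h (graph_adj.2 ⟨huv, he⟩)
    rw [hdelete ⟨s(u, v), huv⟩, graph_reachable_iff] at this
    push Not at this
    obtain ⟨X, hX, hX'⟩ := this
    exact ⟨X, (hcut _ he X).2 ⟨by rw [mem_cut]; tauto, by simpa using hX'⟩⟩
  · intro h u v huv
    obtain ⟨hne, he⟩ := graph_adj.1 huv
    obtain ⟨X, hX⟩ := h _ he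
    rw [hdelete ⟨s(u, v), hne⟩, graph_reachable_iff]
    rw [hcut _ he, mem_cut] at hX
    exact fun hall => hX.2 (hall X hX.1)

theorem IsSpanningTree.isForest (hS : IsSpanningTree S) : IsForest S :=
  graph_isAcyclic_iff.1 hS.2

theorem IsForest.isSpanningTree [Nonempty V] (hS : IsForest S)
    (hcut : ∀ X : Finset V, X.Nonempty → Xᶜ.Nonempty → (S ∩ cut X).Nonempty) :
    IsSpanningTree S := by
  refine ⟨⟨fun u v => graph_reachable_iff.2 fun X hX => ?_⟩, graph_isAcyclic_iff.2 hS⟩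
  by_cases hu : u ∈ X
  · exact hcut X ⟨u, hu⟩ ⟨v, by simp; tauto⟩
  · exact hcut X ⟨v, by tauto⟩ ⟨u, by simpa⟩

end Tree

section SpanningTree

variable {S : Finset (Edge V)}

theorem IsForest.gap_chi_nonneg (hS : IsForest S) {A : Finset V} (hA : A.Nonempty) :
    0 ≤ gap (chi S) 1 A := by
  induction A using Finset.strongInduction with
  | _ A ih =>
  rcases (S ∩ inside A).eq_empty_or_nonempty with hempty | ⟨e, he⟩
  · have : (1 : ℝ) ≤ #A := by exact_mod_cast hA.card_pos
    simpa [gap, weight_chi, hempty]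
  · rw [mem_inter] at he
    obtain ⟨X, hX⟩ := hS e he.1
    have heX := (mem_inter.1 (eq_singleton_iff_unique_mem.1 hX).1).2
    obtain ⟨h1, h2⟩ := nonempty_of_mem_inside_inter_cut (mem_inter.2 ⟨he.2, heX⟩)
    have hsplit := gap_split (chi S) 1 A X
    rw [weight_chi, inter_inside_inter_cut hX he.2, card_singleton, Nat.cast_one] at hsplit
    have := ih (A ∩ X) (inf_lt_left.2 (sdiff_nonempty.1 h2)) h1
    have := ih _ (sdiff_lt_left.2 (not_disjoint_iff_nonempty_inter.2 (by rwa [inter_comm]))) h2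
    linarith

theorem IsSpanningTree.inCone (hS : IsSpanningTree S) : InCone (chi S) 1 where
  nonneg := chi_nonneg S
  gap_nonneg _ := hS.isForest.gap_chi_nonneg
  gap_univ := by
    have := hS.card_add_one
    rw [gap, inside_univ, weight_chi, inter_univ, card_univ, ← this]
    simp

theorem IsSpanningTree.inter_cut_nonempty (hS : IsSpanningTree S) {X : Finset V}
    (hX : X.Nonempty) (hX' : Xᶜ.Nonempty) : (S ∩ cut X).Nonempty := by
  obtain ⟨e, he, hpos⟩ := hS.inCone.exists_mem_inside_inter_cut (A := univ) (X := X)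
    (by rw [hS.inCone.gap_univ]; exact one_pos) (by rwa [univ_inter])
    (by rwa [← compl_eq_univ_sdiff])
  exact ⟨e, mem_inter.2 ⟨chi_pos_iff.1 hpos, (mem_inter.1 he).2⟩⟩

theorem IsSpanningTree.gap_eq_zero_of_card_inter_cut_eq_one (hS : IsSpanningTree S)
    {X : Finset V} (hX : X.Nonempty) (hX' : Xᶜ.Nonempty) (hcard : #(S ∩ cut X) = 1) :
    gap (chi S) 1 X = 0 ∧ gap (chi S) 1 Xᶜ = 0 := by
  have hsplit := gap_split (chi S) 1 univ X
  rw [univ_inter, ← compl_eq_univ_sdiff, hS.inCone.gap_univ, inside_univ, univ_inter, weight_chi,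
    hcard, Nat.cast_one] at hsplit
  have := hS.inCone.gap_nonneg X hX
  have := hS.inCone.gap_nonneg Xᶜ hX'
  constructor <;> linarith

theorem IsForest.insert (hS : IsForest S) {a : Edge V} {X : Finset V} (ha : a ∈ cut X)
    (hX : S ∩ cut X = ∅) : IsForest (insert a S) := by
  have haS : a ∉ S := fun h => notMem_empty a (hX ▸ mem_inter.2 ⟨h, ha⟩)
  intro e he
  rcases mem_insert.1 he with rfl | he
  · exact ⟨X, by rw [insert_inter_of_mem ha, hX]; rfl⟩
  · obtain ⟨Y, hY⟩ := hS e he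
    by_cases haY : a ∈ cut Y
    · refine ⟨Y ∆ X, ?_⟩
      rw [cut_symmDiff, insert_inter_of_notMem (by simp [mem_symmDiff, ha, haY])]
      calc S ∩ cut Y ∆ cut X = (S ∩ cut Y) ∆ (S ∩ cut X) := inf_symmDiff_distrib_left _ _ _
        _ = {e} := by rw [hY, hX]; exact symmDiff_bot _
    · exact ⟨Y, by rw [insert_inter_of_notMem haY, hY]⟩

-- Kruskal's algorithm: the edges of `F` are examined by decreasing `c`.
theorem exists_isForest_forall_le {β : Type*} [LinearOrder β] (c : Edge V → β)
    (F : Finset (Edge V)) :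
    ∃ S ⊆ F, IsForest S ∧ ∀ X, ∀ f ∈ F ∩ cut X, ∃ e ∈ S ∩ cut X, c f ≤ c e := by
  induction F using Finset.induction_on_min_value c with
  | empty => exact ⟨∅, by simp [IsForest]⟩
  | insert a F _ hmin ih =>
  obtain ⟨S, hSF, hS, hcut⟩ := ih
  by_cases hX : ∃ X, a ∈ cut X ∧ S ∩ cut X = ∅
  · obtain ⟨X, ha, hX⟩ := hX
    refine ⟨insert a S, insert_subset_insert a hSF, hS.insert ha hX, fun Y f hf => ?_⟩
    rw [mem_inter, mem_insert] at hf
    rcases hf with ⟨rfl | hfF, hfY⟩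
    · exact ⟨f, by simp [hfY], le_rfl⟩
    · obtain ⟨e, he, hle⟩ := hcut Y f (mem_inter.2 ⟨hfF, hfY⟩)
      exact ⟨e, inter_subset_inter_right (subset_insert a S) he, hle⟩
  · push Not at hX
    refine ⟨S, hSF.trans (subset_insert a F), hS, fun Y f hf => ?_⟩
    rw [mem_inter, mem_insert] at hf
    rcases hf with ⟨rfl | hfF, hfY⟩
    · obtain ⟨e, he⟩ := hX Y hfY
      exact ⟨e, he, hmin e (hSF (mem_inter.1 he).1)⟩
    · exact hcut Y f (mem_inter.2 ⟨hfF, hfY⟩)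

theorem IsSpanningTree.isTight_split (hS : IsSpanningTree S) {A X : Finset V} {e : Edge V}
    (hA : IsTight (chi S) 1 A) (heA : e ∈ inside A) (hX : S ∩ cut X = {e}) :
    IsTight (chi S) 1 (A ∩ X) ∧ IsTight (chi S) 1 (A \ X) := by
  have heX := (mem_inter.1 (eq_singleton_iff_unique_mem.1 hX).1).2
  obtain ⟨h1, h2⟩ := nonempty_of_mem_inside_inter_cut (mem_inter.2 ⟨heA, heX⟩)
  have hsplit := gap_split (chi S) 1 A X
  rw [hA.2, weight_chi, inter_inside_inter_cut hX heA, card_singleton, Nat.cast_one] at hsplit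
  have := hS.inCone.gap_nonneg _ h1
  have := hS.inCone.gap_nonneg _ h2
  exact ⟨⟨h1, by linarith⟩, ⟨h2, by linarith⟩⟩

-- Linear programming duality for maximum-weight spanning trees: the bases of the subtrees of `S`
-- obtained by repeatedly deleting a lightest edge support an optimal dual solution.
theorem IsSpanningTree.weight_mul_le {y : Edge V → ℝ} {σ : ℝ} (hS : IsSpanningTree S)
    (hy : InCone y σ) {t : Edge V → ℝ}
    (ht : ∀ e X, S ∩ cut X = {e} → ∀ f ∈ cut X, 0 < y f → t f ≤ t e)
    {A : Finset V} (hA : IsTight (chi S) 1 A) {m : ℝ} (hm : ∀ e ∈ S ∩ inside A, m ≤ t e) :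
    weight (t * y) (inside A) + m * gap y σ A ≤ σ * weight (t * chi S) (inside A) := by
  induction A using Finset.strongInduction generalizing m with
  | _ A ih =>
  rcases (S ∩ inside A).eq_empty_or_nonempty with hempty | hne
  · have hcard : (#A : ℝ) = 1 := by
      have := hA.2
      rw [gap, weight_chi, hempty, card_empty, Nat.cast_zero] at this
      linarith
    obtain ⟨v, rfl⟩ := card_eq_one.1 (by exact_mod_cast hcard)
    simp [gap, inside_singleton, weight]
  obtain ⟨e, he, hmin⟩ := exists_min_image _ t hne
  rw [mem_inter] at he
  obtain ⟨X, hX⟩ := hS.isForest e he.1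
  have hchi (z : Edge V → ℝ) : weight (z * chi S) (inside A ∩ cut X) = z e := by
    rw [weight_mul_chi, inter_inside_inter_cut hX he.2, weight, sum_singleton]
  have hcross : weight (t * y) (inside A ∩ cut X) ≤ t e * weight y (inside A ∩ cut X) :=
    weight_mul_le_mul_weight hy.nonneg fun f hf => ht e X hX f (mem_inter.1 hf).2
  obtain ⟨h1, h2⟩ := hS.isTight_split hA he.2 hX
  have ih1 := ih (A ∩ X) (inf_lt_left.2 (sdiff_nonempty.1 h2.1)) h1 (m := t e) fun f hf =>
    hmin f (inter_subset_inter_left (inside_mono inter_subset_left) hf)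
  have ih2 := ih (A \ X)
    (sdiff_lt_left.2 (not_disjoint_iff_nonempty_inter.2 (by rw [inter_comm]; exact h1.1))) h2
    (m := t e) fun f hf => hmin f (inter_subset_inter_left (inside_mono sdiff_subset) hf)
  calc weight (t * y) (inside A) + m * gap y σ A
      ≤ weight (t * y) (inside A) + t e * gap y σ A := by
        gcongr
        · exact hy.gap_nonneg A hA.1
        · exact hm e (mem_inter.2 he)
    _ ≤ (weight (t * y) (inside (A ∩ X)) + t e * gap y σ (A ∩ X)) +
          (weight (t * y) (inside (A \ X)) + t e * gap y σ (A \ X)) + σ * t e := by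
        linarith [weight_inside_split (t * y) A X, congrArg (t e * ·) (gap_split y σ A X)]
    _ ≤ σ * weight (t * chi S) (inside (A ∩ X)) + σ * weight (t * chi S) (inside (A \ X)) +
          σ * t e := by
        gcongr
    _ = σ * weight (t * chi S) (inside A) := by
        rw [weight_inside_split (t * chi S) A X, hchi t]
        ring

end SpanningTree

section FaceTree

/-- `S` is a spanning tree in the minimal face of the spanning tree polytope containing `σ⁻¹ y`:
its characteristic vector is tight for every inequality that is tight for `y`. -/
structure IsFaceTree (y : Edge V → ℝ) (σ : ℝ) (S : Finset (Edge V)) : Prop where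
  isSpanningTree : IsSpanningTree S
  pos : ∀ e ∈ S, 0 < y e
  isTight : ∀ A, IsTight y σ A → IsTight (chi S) 1 A

open Classical in
/-- The family of all tight sets. -/
noncomputable def tightSets (y : Edge V → ℝ) (σ : ℝ) : Finset (Finset V) :=
  univ.filter (IsTight y σ)

/-- The intersection of all tight sets containing both endpoints of `e`. -/
noncomputable def tightHull (y : Edge V → ℝ) (σ : ℝ) (e : Edge V) : Finset V :=
  ((tightSets y σ).filter (e ∈ inside ·)).inf id

/-- The number of tight sets containing both endpoints of `e`. -/
noncomputable def tightCount (y : Edge V → ℝ) (σ : ℝ) (e : Edge V) : ℕ :=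
  #((tightSets y σ).filter (e ∈ inside ·))

variable {y : Edge V → ℝ} {σ : ℝ} {S : Finset (Edge V)} {A : Finset V} {e f : Edge V}

theorem mem_tightSets : A ∈ tightSets y σ ↔ IsTight y σ A := by
  simp [tightSets]

theorem tightHull_subset (hA : IsTight y σ A) (he : e ∈ inside A) : tightHull y σ e ⊆ A :=
  inf_le (f := id) (mem_filter.2 ⟨mem_tightSets.2 hA, he⟩)

theorem InCone.isTight_tightHull [Nonempty V] (hy : InCone y σ) (e : Edge V) :
    IsTight y σ (tightHull y σ e) ∧ e ∈ inside (tightHull y σ e) := by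
  refine inf_induction (p := fun A => IsTight y σ A ∧ e ∈ inside A)
    ⟨hy.isTight_univ, by simp [inside_univ]⟩ ?_
    fun A hA => (mem_filter.1 hA).imp_left mem_tightSets.1
  rintro A ⟨hA, heA⟩ B ⟨hB, heB⟩
  have he : e ∈ inside (A ∩ B) := by rw [inside_inter]; exact mem_inter.2 ⟨heA, heB⟩
  refine ⟨hy.isTight_inter hA hB ?_, he⟩
  obtain ⟨u, v, huv, rfl⟩ := e.exists_eq
  exact ⟨u, (mem_inside.1 he).1⟩

theorem tightCount_le_of_mem_inside_tightHull (hf : f ∈ inside (tightHull y σ e)) :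
    tightCount y σ e ≤ tightCount y σ f :=
  card_le_card <| monotone_filter_right _ fun _ hA heA =>
    inside_mono (tightHull_subset (mem_tightSets.1 hA) heA) hf

theorem weight_tightCount_mul (y z : Edge V → ℝ) (σ : ℝ) :
    weight ((fun e => (tightCount y σ e : ℝ)) * z) univ =
      ∑ A ∈ tightSets y σ, weight z (inside A) := by
  simp only [weight_eq_sum_ite z]
  rw [sum_comm]
  simp [weight, tightCount, ← sum_filter]

theorem InCone.isTight_chi [Nonempty V] (hy : InCone y σ) (hσ : 0 < σ) (hS : IsSpanningTree S)
    (hcount : ∀ e X, S ∩ cut X = {e} → ∀ f ∈ cut X, 0 < y f →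
      tightCount y σ f ≤ tightCount y σ e)
    (hA : IsTight y σ A) : IsTight (chi S) 1 A := by
  have hdual := hS.weight_mul_le hy (t := fun e => (tightCount y σ e : ℝ))
    (fun e X hX f hf hpos => by exact_mod_cast hcount e X hX f hf hpos)
    hS.inCone.isTight_univ (m := 0) fun e _ => Nat.cast_nonneg _
  simp only [inside_univ, weight_tightCount_mul, zero_mul, add_zero] at hdual
  have hnonneg : ∀ B ∈ tightSets y σ, 0 ≤ gap (chi S) 1 B := fun B hB =>
    hS.inCone.gap_nonneg B (mem_tightSets.1 hB).1
  have hscale : ∀ B ∈ tightSets y σ,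
      σ * gap (chi S) 1 B = weight y (inside B) - σ * weight (chi S) (inside B) := by
    intro B hB
    have := (mem_tightSets.1 hB).2
    unfold gap at *
    linarith
  have hsum : ∑ B ∈ tightSets y σ, gap (chi S) 1 B ≤ 0 := by
    refine nonpos_of_mul_nonpos_right ?_ hσ
    rw [mul_sum, sum_congr rfl hscale, sum_sub_distrib, ← mul_sum]
    exact sub_nonpos.2 hdual
  exact ⟨hA.1, (sum_eq_zero_iff_of_nonneg hnonneg).1 (hsum.antisymm (sum_nonneg hnonneg)) A
    (mem_tightSets.2 hA)⟩

theorem InCone.exists_isFaceTree [Nonempty V] (hy : InCone y σ) (hσ : 0 < σ) (r : Edge V → ℕ) :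
    ∃ S, IsFaceTree y σ S ∧ ∀ e X, S ∩ cut X = {e} →
      ∀ f ∈ inside (tightHull y σ e) ∩ cut X, 0 < y f → r e ≤ r f := by
  classical
  obtain ⟨S, hsupp, hS, hle⟩ := exists_isForest_forall_le
    (fun e => toLex (tightCount y σ e, OrderDual.toDual (r e))) (univ.filter fun e => 0 < y e)
  have hmax : ∀ e X, S ∩ cut X = {e} → ∀ f ∈ cut X, 0 < y f →
      toLex (tightCount y σ f, OrderDual.toDual (r f)) ≤
        toLex (tightCount y σ e, OrderDual.toDual (r e)) := by
    intro e X hX f hf hpos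
    obtain ⟨g, hg, hfg⟩ := hle X f (by simp [hf, hpos])
    rw [hX, mem_singleton] at hg
    rwa [← hg]
  have htree : IsSpanningTree S := hS.isSpanningTree fun X hX hX' => by
    obtain ⟨f, hf, hpos⟩ := hy.exists_mem_inside_inter_cut (A := univ) (X := X)
      (by rwa [hy.gap_univ]) (by rwa [univ_inter]) (by rwa [← compl_eq_univ_sdiff])
    obtain ⟨e, he, -⟩ := hle X f (by simp [(mem_inter.1 hf).2, hpos])
    exact ⟨e, he⟩
  refine ⟨S, ⟨htree, fun e he => (mem_filter.1 (hsupp he)).2, fun A hA =>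
    hy.isTight_chi hσ htree (fun e X hX f hf hpos => ?_) hA⟩,
    fun e X hX f hf hpos => ?_⟩
  · exact Prod.Lex.monotone_fst _ _ (hmax e X hX f hf hpos)
  · rw [mem_inter] at hf
    have h := Prod.Lex.toLex_le_toLex.1 (hmax e X hX f hf.2 hpos)
    exact (h.resolve_left (tightCount_le_of_mem_inside_tightHull hf.1).not_gt).2

end FaceTree

section ThinChain

/-- A chain of vertex sets `L` for which the rank constraints at `L` and `Lᶜ` both have slack less
than `σ / 2`. The narrow cuts of the path TSP are of this form, and nothing else about them is
needed to find a Gao tree. -/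
structure IsThinChain (y : Edge V → ℝ) (σ : ℝ) (𝓛 : Finset (Finset V)) : Prop where
  subset_or_subset : ∀ L ∈ 𝓛, ∀ M ∈ 𝓛, L ⊆ M ∨ M ⊆ L
  gap_lt : ∀ L ∈ 𝓛, gap y σ L < σ / 2
  gap_compl_lt : ∀ L ∈ 𝓛, gap y σ Lᶜ < σ / 2

/-- The number of members of `𝓛` crossed by `e`. -/
def crossings (𝓛 : Finset (Finset V)) (e : Edge V) : ℕ :=
  #(𝓛.filter (e ∈ cut ·))

/-- A face tree in which no edge can be exchanged, inside its tight hull, for an edge crossing fewer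
members of `𝓛`. -/
structure IsMinCrossingTree (y : Edge V → ℝ) (σ : ℝ) (𝓛 : Finset (Finset V))
    (S : Finset (Edge V)) : Prop extends IsFaceTree y σ S where
  crossings_le : ∀ e X, S ∩ cut X = {e} → ∀ f ∈ inside (tightHull y σ e) ∩ cut X, 0 < y f →
    crossings 𝓛 e ≤ crossings 𝓛 f

variable {y : Edge V → ℝ} {σ : ℝ} {𝓛 : Finset (Finset V)} {S : Finset (Edge V)}
  {A L M X : Finset V} {e f : Edge V} {p q : V}

theorem IsThinChain.weight_cut_lt (h𝓛 : IsThinChain y σ 𝓛) (hy : InCone y σ) (hL : L ∈ 𝓛) :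
    weight y (cut L) < 2 * σ := by
  have h := gap_split y σ univ L
  rw [univ_inter, ← compl_eq_univ_sdiff, hy.gap_univ, inside_univ, univ_inter] at h
  linarith [h𝓛.gap_lt L hL, h𝓛.gap_compl_lt L hL]

theorem IsThinChain.weight_inside_inter_cut_lt (h𝓛 : IsThinChain y σ 𝓛) (hy : InCone y σ)
    (hL : L ∈ 𝓛) (hM : M ∈ 𝓛) (hLM : L ⊂ M) (hA : A ∩ M ⊆ L) :
    weight y (inside A ∩ cut L) < σ := by
  have huncross := gap_uncross y σ M Lᶜ
  have hunion : M ∪ Lᶜ = univ := by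
    have := hLM.1
    ext v; simp; grind
  have hnonneg : 0 ≤ gap y σ (M ∩ Lᶜ) :=
    hy.gap_nonneg _ (by rw [← sdiff_eq_inter_compl]; exact sdiff_nonempty.2 hLM.2)
  have hsub : inside A ∩ cut L ⊆ between (M \ Lᶜ) (Lᶜ \ M) := by
    intro e he
    obtain ⟨u, v, huv, rfl⟩ := e.exists_eq
    have hu := @hA u
    have hv := @hA v
    have hu' := @hLM.1 u
    have hv' := @hLM.1 v
    simp only [mem_inter, mem_inside, mem_cut, mem_between, mem_sdiff, mem_compl] at *
    tauto
  rw [hunion, hy.gap_univ] at huncross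
  linarith [weight_mono hy.nonneg hsub, h𝓛.gap_lt M hM, h𝓛.gap_compl_lt L hL]

theorem IsThinChain.image_compl (h𝓛 : IsThinChain y σ 𝓛) :
    IsThinChain y σ (𝓛.image compl) where
  subset_or_subset := by
    simp only [forall_mem_image, compl_subset_compl]
    exact fun L hL M hM => h𝓛.subset_or_subset M hM L hL
  gap_lt := forall_mem_image.2 h𝓛.gap_compl_lt
  gap_compl_lt := by simpa only [forall_mem_image, compl_compl] using h𝓛.gap_lt

theorem IsThinChain.exists_least (h𝓛 : IsThinChain y σ 𝓛) (hy : InCone y σ) (hσ : 0 < σ)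
    (p q : V) : ∃ M, p ∈ M ∧ q ∈ M ∧ gap y σ M < σ / 2 ∧ ∀ L ∈ 𝓛, p ∈ L → q ∈ L → M ⊆ L := by
  rcases (𝓛.filter fun L => p ∈ L ∧ q ∈ L).eq_empty_or_nonempty with hempty | hne
  · refine ⟨univ, mem_univ p, mem_univ q, by linarith [hy.gap_univ], fun L hL hp hq => ?_⟩
    exact absurd (mem_filter.2 ⟨hL, hp, hq⟩) (hempty ▸ notMem_empty L)
  · obtain ⟨M, hmin⟩ := exists_minimal hne
    obtain ⟨hM, hp, hq⟩ := mem_filter.1 hmin.prop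
    exact ⟨M, hp, hq, h𝓛.gap_lt M hM, fun L hL hpL hqL =>
      (h𝓛.subset_or_subset M hM L hL).elim id
        fun h => hmin.le_of_le (mem_filter.2 ⟨hL, hpL, hqL⟩) h⟩

-- `W` is the difference of the consecutive members of `𝓛` enclosing `p` and `q`.
theorem IsThinChain.exists_window (h𝓛 : IsThinChain y σ 𝓛) (hy : InCone y σ) (hσ : 0 < σ)
    (p q : V) : ∃ W, p ∈ W ∧ q ∈ W ∧ gap y σ W < σ ∧
      ∀ L ∈ 𝓛, (inside W ∩ cut L).Nonempty → ¬ (p ∈ L ↔ q ∈ L) := by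
  obtain ⟨M, hpM, hqM, hMgap, hM⟩ := h𝓛.exists_least hy hσ p q
  obtain ⟨N, hpN, hqN, hNgap, hN⟩ := h𝓛.image_compl.exists_least hy hσ p q
  simp only [forall_mem_image, mem_compl] at hN
  refine ⟨M ∩ N, by simp [*], by simp [*], ?_, fun L hL ⟨e, he⟩ hpq => ?_⟩
  · linarith [gap_uncross y σ M N, hy.gap_nonneg (M ∪ N) ⟨p, mem_union_left N hpM⟩,
      weight_nonneg hy.nonneg (between (M \ N) (N \ M))]
  · obtain ⟨h1, h2⟩ := nonempty_of_mem_inside_inter_cut he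
    by_cases hp : p ∈ L
    · exact h2.ne_empty (sdiff_eq_empty_iff_subset.2
        (inter_subset_left.trans (hM L hL hp (hpq.1 hp))))
    · exact h1.ne_empty (disjoint_iff_inter_eq_empty.1 ((le_compl_iff_disjoint_right.1
        (inter_subset_right.trans (hN hL hp (mt hpq.2 hp))))))

-- Otherwise a window around `p` and `q` contains an edge exchangeable for `e` with fewer crossings.
theorem IsMinCrossingTree.mem_iff_mem [Nonempty V] (hS : IsMinCrossingTree y σ 𝓛 S)
    (h𝓛 : IsThinChain y σ 𝓛) (hy : InCone y σ) (hσ : 0 < σ) (hX : S ∩ cut X = {e})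
    (hp : p ∈ tightHull y σ e) (hq : q ∈ tightHull y σ e)
    (hpq : ∀ M ∈ 𝓛, ¬ (p ∈ M ↔ q ∈ M) → e ∈ cut M)
    (hL : L ∈ 𝓛) (heL : e ∈ cut L) (hpqL : p ∈ L ↔ q ∈ L) : p ∈ X ↔ q ∈ X := by
  by_contra hsep
  obtain ⟨W, hpW, hqW, hgap, hW⟩ := h𝓛.exists_window hy hσ p q
  have hsides : ((tightHull y σ e ∩ W) ∩ X).Nonempty ∧ ((tightHull y σ e ∩ W) \ X).Nonempty := by
    by_cases hpX : p ∈ X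
    · exact ⟨⟨p, by simp [*]⟩, ⟨q, by simp_all⟩⟩
    · exact ⟨⟨q, by simp_all⟩, ⟨p, by simp [*]⟩⟩
  obtain ⟨f, hf, hpos⟩ := hy.exists_mem_inside_inter_cut
    ((hy.gap_inter_le (hy.isTight_tightHull e).1).trans_lt hgap) hsides.1 hsides.2
  rw [inside_inter, mem_inter, mem_inter] at hf
  refine (hS.crossings_le e X hX f (mem_inter.2 ⟨hf.1.1, hf.2⟩) hpos).not_gt (card_lt_card ?_)
  have hcross : ∀ M ∈ 𝓛, f ∈ cut M → ¬ (p ∈ M ↔ q ∈ M) := fun M hM hfM =>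
    hW M hM ⟨f, mem_inter.2 ⟨hf.1.2, hfM⟩⟩
  refine (ssubset_iff_of_subset fun M hM => ?_).2 ⟨L, by simp [hL, heL], fun hfL => ?_⟩
  · rw [mem_filter] at hM ⊢
    exact ⟨hM.1, hpq M hM.1 (hcross M hM.1 hM.2)⟩
  · exact hcross L hL (mem_filter.1 hfL).2 hpqL

theorem IsMinCrossingTree.eq_of_mem_cut [Nonempty V] (hS : IsMinCrossingTree y σ 𝓛 S)
    (h𝓛 : IsThinChain y σ 𝓛) (hy : InCone y σ) (hσ : 0 < σ) (he : e ∈ S)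
    (hL : L ∈ 𝓛) (hM : M ∈ 𝓛) (heL : e ∈ cut L) (heM : e ∈ cut M) : L = M := by
  wlog hLM : L ⊆ M generalizing L M
  · exact (this hM hL heM heL ((h𝓛.subset_or_subset L hL M hM).resolve_left hLM)).symm
  by_contra hne
  obtain ⟨hH, heH⟩ := hy.isTight_tightHull e
  have hempty : tightHull y σ e ∩ M ⊆ L := by
    intro w hw
    by_contra hwL
    obtain ⟨hwH, hwM⟩ := mem_inter.1 hw
    obtain ⟨X, hX⟩ := hS.isSpanningTree.isForest e he
    have heX := (mem_inter.1 (eq_singleton_iff_unique_mem.1 hX).1).2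
    obtain ⟨u, hu, v, hv, huv, rfl⟩ := exists_eq_of_mem_cut heL
    rw [mem_inside] at heH
    simp only [mem_cut] at heL heM heX
    have hchain := fun N hN => And.intro (h𝓛.subset_or_subset L hL N hN)
      (h𝓛.subset_or_subset M hM N hN)
    have huw := hS.mem_iff_mem h𝓛 hy hσ hX heH.1 hwH (fun N hN h => by
      rw [mem_cut]; grind) hM (mem_cut.2 heM) (by grind)
    have hvw := hS.mem_iff_mem h𝓛 hy hσ hX heH.2 hwH (fun N hN h => by
      rw [mem_cut]; grind) hL (mem_cut.2 heL) (by grind)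
    exact heX (huw.trans hvw.symm)
  obtain ⟨hinter, hdiff⟩ := nonempty_of_mem_inside_inter_cut (mem_inter.2 ⟨heH, heL⟩)
  linarith [hy.sub_gap_le_weight hinter hdiff, hH.2,
    h𝓛.weight_inside_inter_cut_lt hy hL hM (hLM.ssubset_of_ne hne) hempty]

theorem IsMinCrossingTree.eq_of_mem_inside_tightHull [Nonempty V]
    (hS : IsMinCrossingTree y σ 𝓛 S) (h𝓛 : IsThinChain y σ 𝓛) (hy : InCone y σ) (hσ : 0 < σ)
    (he : e ∈ S) (hf : f ∈ S) (hL : L ∈ 𝓛) (heL : e ∈ cut L) (hfL : f ∈ cut L)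
    (hfe : f ∈ inside (tightHull y σ e)) : f = e := by
  by_contra hne
  obtain ⟨X, hX⟩ := hS.isSpanningTree.isForest e he
  have heX := (mem_inter.1 (eq_singleton_iff_unique_mem.1 hX).1).2
  have hfX : f ∉ cut X := fun h => hne (mem_singleton.1 (hX ▸ mem_inter.2 ⟨hf, h⟩))
  have honly {g : Edge V} (hg : g ∈ S) (hgL : g ∈ cut L) : ∀ N ∈ 𝓛, N ≠ L → g ∉ cut N :=
    fun N hN hNL hgN => hNL (hS.eq_of_mem_cut h𝓛 hy hσ hg hN hL hgN hgL)
  have heN := honly he heL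
  have hfN := honly hf hfL
  have heH := (hy.isTight_tightHull e).2
  have heL' := heL
  obtain ⟨u, hu, v, hv, huv, rfl⟩ := exists_eq_of_mem_cut heL
  obtain ⟨a, ha, b, hb, hab, rfl⟩ := exists_eq_of_mem_cut hfL
  simp only [mem_cut, mem_inside, not_not] at heX hfX heN hfN heH hfe
  have hchain := h𝓛.subset_or_subset L hL
  have hua := hS.mem_iff_mem h𝓛 hy hσ hX heH.1 hfe.1 (by grind) hL heL' (by simp [hu, ha])
  have hvb := hS.mem_iff_mem h𝓛 hy hσ hX heH.2 hfe.2 (by grind) hL heL' (by simp [hv, hb])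
  exact heX (hua.trans (hfX.trans hvb.symm))

theorem IsMinCrossingTree.card_inter_cut_le_one [Nonempty V] (hS : IsMinCrossingTree y σ 𝓛 S)
    (h𝓛 : IsThinChain y σ 𝓛) (hy : InCone y σ) (hσ : 0 < σ) (hL : L ∈ 𝓛) :
    #(S ∩ cut L) ≤ 1 := by
  refine card_le_one.2 fun e he f hf => ?_
  rw [mem_inter] at he hf
  have hweight (g : Edge V) (hg : g ∈ cut L) :
      σ ≤ weight y (inside (tightHull y σ g) ∩ cut L) := by
    obtain ⟨hH, hgH⟩ := hy.isTight_tightHull g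
    obtain ⟨h1, h2⟩ := nonempty_of_mem_inside_inter_cut (mem_inter.2 ⟨hgH, hg⟩)
    linarith [hy.sub_gap_le_weight h1 h2, hH.2]
  have hmeet : ¬ Disjoint (inside (tightHull y σ e) ∩ cut L)
      (inside (tightHull y σ f) ∩ cut L) := fun hdisj => by
    have hle := weight_mono hy.nonneg (union_subset inter_subset_right inter_subset_right :
      (inside (tightHull y σ e) ∩ cut L) ∪ (inside (tightHull y σ f) ∩ cut L) ⊆ cut L)
    rw [weight, sum_union hdisj] at hle
    have := hweight e he.2
    have := hweight f hf.2
    have := h𝓛.weight_cut_lt hy hL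
    unfold weight at *
    linarith
  obtain ⟨g, hg⟩ := not_disjoint_iff_nonempty_inter.1 hmeet
  have hgH : g ∈ inside (tightHull y σ e ∩ tightHull y σ f) ∩ cut L := by
    rw [inside_inter]; simp_all
  obtain ⟨h1, h2⟩ := nonempty_of_mem_inside_inter_cut hgH
  have htight := hS.isTight _ (hy.isTight_inter (hy.isTight_tightHull e).1
    (hy.isTight_tightHull f).1 (h1.mono inter_subset_left))
  obtain ⟨k, hk, hkS⟩ := hS.isSpanningTree.inCone.exists_mem_inside_inter_cut
    (htight.2.trans_lt one_pos) h1 h2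
  rw [chi_pos_iff] at hkS
  rw [mem_inter, inside_inter, mem_inter] at hk
  calc e = k := (hS.eq_of_mem_inside_tightHull h𝓛 hy hσ he.1 hkS hL he.2 hk.2 hk.1.1).symm
    _ = f := hS.eq_of_mem_inside_tightHull h𝓛 hy hσ hf.1 hkS hL hf.2 hk.2 hk.1.2

theorem InCone.exists_card_inter_cut_eq_one [Nonempty V] (hy : InCone y σ) (hσ : 0 < σ)
    (h𝓛 : IsThinChain y σ 𝓛) (hproper : ∀ L ∈ 𝓛, L.Nonempty ∧ Lᶜ.Nonempty) :
    ∃ S, IsFaceTree y σ S ∧ ∀ L ∈ 𝓛, #(S ∩ cut L) = 1 := by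
  obtain ⟨S, hS, hle⟩ := hy.exists_isFaceTree hσ (crossings 𝓛)
  refine ⟨S, hS, fun L hL => le_antisymm
    (IsMinCrossingTree.card_inter_cut_le_one ⟨hS, hle⟩ h𝓛 hy hσ hL) ?_⟩
  exact card_pos.2 (hS.isSpanningTree.inter_cut_nonempty (hproper L hL).1 (hproper L hL).2)

end ThinChain

section Decomposition

variable {z : Edge V → ℝ} {σ : ℝ} {S : Finset (Edge V)}

theorem InCone.eq_zero (hz : InCone z 0) : z = 0 := by
  have hsum : ∑ e, z e = 0 := by
    simpa [gap, inside_univ, weight] using hz.gap_univ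
  exact (Fintype.sum_eq_zero_iff_of_nonneg hz.nonneg).1 hsum

theorem InCone.scale_nonneg [Nontrivial V] (hz : InCone z σ) : 0 ≤ σ := by
  have hcard : (1 : ℝ) < Fintype.card V := by exact_mod_cast Fintype.one_lt_card
  have h := hz.gap_univ
  rw [gap, sub_eq_zero, card_univ] at h
  exact nonneg_of_mul_nonneg_left (h ▸ weight_nonneg hz.nonneg _) (sub_pos.2 hcard)

/-- The slacks of all inequalities of `InCone`, as one family. -/
def slack (z : Edge V → ℝ) (σ : ℝ) : Edge V ⊕ {A : Finset V // A.Nonempty} → ℝ :=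
  Sum.elim z fun A => gap z σ A

theorem InCone.slack_nonneg (hz : InCone z σ) (i) : 0 ≤ slack z σ i :=
  i.rec hz.nonneg fun A => hz.gap_nonneg A A.2

theorem slack_sub_smul (y z : Edge V → ℝ) (σ τ c : ℝ) (i) :
    slack (y - c • z) (σ - c * τ) i = slack y σ i - c * slack z τ i := by
  cases i
  · simp [slack]
  · exact gap_sub_smul y z σ τ c _

theorem InCone.sub_smul {y : Edge V → ℝ} {τ c : ℝ} (hy : InCone y σ) (hz : InCone z τ)
    (h : ∀ i, c * slack z τ i ≤ slack y σ i) : InCone (y - c • z) (σ - c * τ) where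
  nonneg e := sub_nonneg.2 (h (.inl e))
  gap_nonneg A hA := by
    rw [gap_sub_smul]
    exact sub_nonneg.2 (h (.inr ⟨A, hA⟩))
  gap_univ := by rw [gap_sub_smul, hy.gap_univ, hz.gap_univ]; simp

theorem IsFaceTree.slack_pos (hS : IsFaceTree z σ S) (hz : InCone z σ)
    {i : Edge V ⊕ {A : Finset V // A.Nonempty}} (hi : 0 < slack (chi S) 1 i) :
    0 < slack z σ i := by
  refine (hz.slack_nonneg i).lt_of_ne' fun hzero => ?_
  rcases i with e | A
  · exact (hS.pos e (chi_pos_iff.1 hi)).ne' hzero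
  · exact hi.ne' (hS.isTight A ⟨A.2, hzero⟩).2

open Classical in
/-- The number of inequalities of `InCone` that are strict for `z`. -/
noncomputable def slackCount (z : Edge V → ℝ) (σ : ℝ) : ℕ :=
  #(univ.filter (0 < slack z σ ·))

theorem IsFaceTree.exists_peel [Nontrivial V] (hS : IsFaceTree z σ S) (hz : InCone z σ) :
    ∃ ε > 0, InCone (z - ε • chi S) (σ - ε) ∧
      slackCount (z - ε • chi S) (σ - ε) < slackCount z σ := by
  classical
  have hchi := hS.isSpanningTree.inCone
  obtain ⟨e, he⟩ : S.Nonempty := card_pos.1 (by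
    have := hS.isSpanningTree.card_add_one
    have := Fintype.one_lt_card (α := V)
    lia)
  obtain ⟨ε, hε, hle, i, hi, heq⟩ := exists_max_step hz.slack_nonneg
    (fun i => hS.slack_pos hz) ⟨.inl e, chi_pos_iff.2 he⟩
  have hslack := slack_sub_smul z (chi S) σ 1 ε
  have hcone := hz.sub_smul hchi hle
  rw [mul_one] at hslack hcone
  refine ⟨ε, hε, hcone, card_lt_card ((ssubset_iff_of_subset fun j hj => ?_).2 ⟨i, ?_, ?_⟩)⟩
  · simp only [mem_filter, mem_univ, true_and, hslack] at hj ⊢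
    exact (sub_pos.1 hj).trans_le' (mul_nonneg hε.le (hchi.slack_nonneg j))
  · simpa using hi
  · simp [hslack, heq]

-- Peeling off a face tree keeps the gaps of the sets with `θ L < σ`, since the tree is tight there.
theorem InCone.exists_decomposition [Nontrivial V] {𝓛 : Finset (Finset V)} {θ : Finset V → ℝ}
    (hz : InCone z σ) (hchain : ∀ L ∈ 𝓛, ∀ M ∈ 𝓛, L ⊆ M ∨ M ⊆ L)
    (hproper : ∀ L ∈ 𝓛, L.Nonempty ∧ Lᶜ.Nonempty)
    (hgap : ∀ L ∈ 𝓛, θ L < σ → gap z σ L ≤ θ L / 2 ∧ gap z σ Lᶜ ≤ θ L / 2) :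
    ∃ (r : ℕ) (S : Fin r → Finset (Edge V)) (p : Fin r → ℝ),
      (∀ j, IsSpanningTree (S j)) ∧ (∀ j, 0 < p j) ∧ ∑ j, p j = σ ∧ z = ∑ j, p j • chi (S j) ∧
      ∀ j, ∀ L ∈ 𝓛, θ L + ∑ i ∈ Iio j, p i < σ → #(S j ∩ cut L) = 1 := by
  induction hn : slackCount z σ using Nat.strong_induction_on generalizing z σ with
  | _ n ih =>
  rcases hz.scale_nonneg.eq_or_lt with rfl | hσ
  · exact ⟨0, Fin.elim0, Fin.elim0, by simp, by simp, by simp, by simpa using hz.eq_zero, by simp⟩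
  have hthin : IsThinChain z σ (𝓛.filter (θ · < σ)) := by
    refine ⟨fun L hL M hM => hchain L (mem_filter.1 hL).1 M (mem_filter.1 hM).1,
      fun L hL => ?_, fun L hL => ?_⟩ <;>
    · obtain ⟨hL, hlt⟩ := mem_filter.1 hL
      have := hgap L hL hlt
      linarith
  obtain ⟨T, hT, hT1⟩ := hz.exists_card_inter_cut_eq_one hσ hthin
    fun L hL => hproper L (mem_filter.1 hL).1
  replace hT1 : ∀ L ∈ 𝓛, θ L < σ → #(T ∩ cut L) = 1 := fun L hL h => hT1 L (by simp [hL, h])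
  obtain ⟨ε, hε, hcone, hlt⟩ := hT.exists_peel hz
  obtain ⟨r, S, p, hS, hp, hsum, hdec, hcut⟩ := ih _ (hn ▸ hlt) hcone (fun L hL h => by
    have hlt : θ L < σ := by linarith
    obtain ⟨h1, h2⟩ := hT.isSpanningTree.gap_eq_zero_of_card_inter_cut_eq_one
      (hproper L hL).1 (hproper L hL).2 (hT1 L hL hlt)
    have hsub := gap_sub_smul z (chi T) σ 1 ε
    rw [mul_one] at hsub
    rw [hsub, hsub, h1, h2, mul_zero, sub_zero, sub_zero]
    exact hgap L hL hlt) rfl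
  refine ⟨r + 1, Fin.cons T S, Fin.cons ε p, Fin.cases hT.isSpanningTree hS, Fin.cases hε hp,
    by simp [Fin.sum_univ_succ, hsum], by simp [Fin.sum_univ_succ, ← hdec],
    Fin.cases (fun L hL h => ?_) fun j L hL h => ?_⟩
  · exact hT1 L hL (by simpa [← filter_gt_eq_Iio] using h)
  · rw [sum_Iio_succ_cons] at h
    exact hcut j L hL (by linarith)

end Decomposition

section Feasible

variable {s t : V} {x : Edge V → ℝ} {A L M U : Finset V} {C : Finset (Edge V)}

theorem sum_weight_cut_singleton (y : Edge V → ℝ) (A : Finset V) :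
    ∑ v ∈ A, weight y (cut {v}) = 2 * weight y (inside A) + weight y (cut A) := by
  simp only [weight_eq_sum_ite, mul_sum, ← sum_add_distrib]
  rw [sum_comm]
  refine sum_congr rfl fun e _ => ?_
  obtain ⟨u, w, huw, rfl⟩ := e.exists_eq
  have hne : u ≠ w := huw
  have hends (v : V) (c : ℝ) : (if ¬ (u = v ↔ w = v) then c else 0) =
      (if u = v then c else 0) + (if w = v then c else 0) := by
    by_cases u = v <;> by_cases w = v <;> simp_all
  simp only [mem_cut, mem_singleton, hends, sum_add_distrib, sum_ite_eq, mem_inside]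
  by_cases u ∈ A <;> by_cases w ∈ A <;> simp [*, two_mul]

theorem IsFeasible.gap_eq (hx : IsFeasible s t x) (hst : s ≠ t) (A : Finset V) :
    gap x 1 A = weight x (cut A) / 2 + (#(A ∩ {s, t}) : ℝ) / 2 - 1 := by
  have hdegree (v : V) : weight x (cut {v}) =
      2 - (if s = v then 1 else 0) - (if t = v then 1 else 0) := by
    by_cases hs : s = v
    · subst hs
      rw [hx.degree_left, if_pos rfl, if_neg hst.symm]
      norm_num
    by_cases ht : t = v
    · subst ht
      rw [hx.degree_right, if_neg hs, if_pos rfl]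
      norm_num
    · rw [hx.degree_inner v (Ne.symm hs) (Ne.symm ht), if_neg hs, if_neg ht]
      norm_num
  have hsum := sum_weight_cut_singleton x A
  simp only [hdegree, sum_sub_distrib, sum_ite_eq, sum_const, nsmul_eq_mul] at hsum
  rw [card_inter_pair hst, gap]
  push_cast
  linarith

theorem IsFeasible.inCone (hx : IsFeasible s t x) (hst : s ≠ t) : InCone x 1 where
  nonneg := hx.nonneg
  gap_nonneg A hA := by
    rw [hx.gap_eq hst]
    by_cases hu : A = univ
    · subst hu
      rw [cut_univ, univ_inter, card_pair hst]
      simp [weight]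
    rcases Nat.even_or_odd #(A ∩ {s, t}) with h | h
    · have := hx.even_cut A hA hu h
      have : (0 : ℝ) ≤ #(A ∩ {s, t}) := Nat.cast_nonneg _
      linarith
    · have := hx.odd_cut A hA hu h
      have : (1 : ℝ) ≤ #(A ∩ {s, t}) := by exact_mod_cast h.pos
      linarith
  gap_univ := by
    rw [hx.gap_eq hst, cut_univ, univ_inter, card_pair hst]
    simp [weight]

/-- `L` separates `s` from `t` and its cut is narrow. Every narrow cut is `cut L` for such an `L`,
the side containing `s`. -/
structure IsNarrowSide (s t : V) (x : Edge V → ℝ) (L : Finset V) : Prop where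
  left_mem : s ∈ L
  right_notMem : t ∉ L
  weight_lt : weight x (cut L) < 2

theorem IsFeasible.gap_isNarrowSide (hx : IsFeasible s t x) (hst : s ≠ t)
    (hL : IsNarrowSide s t x L) :
    gap x 1 L = (weight x (cut L) - 1) / 2 ∧ gap x 1 Lᶜ = (weight x (cut L) - 1) / 2 := by
  rw [hx.gap_eq hst, hx.gap_eq hst, cut_compl, card_inter_pair hst, card_inter_pair hst]
  simp only [hL.left_mem, hL.right_notMem, mem_compl, not_true_eq_false, not_false_eq_true, if_true,
    if_false]
  constructor <;> push_cast <;> ring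

-- Otherwise `L ∪ Mᶜ` is a proper set containing `s` and `t`, whose cut has weight at least `2`;
-- uncrossing `L` and `Mᶜ` contradicts this.
theorem IsFeasible.subset_or_subset (hx : IsFeasible s t x) (hst : s ≠ t)
    (hL : IsNarrowSide s t x L) (hM : IsNarrowSide s t x M) : L ⊆ M ∨ M ⊆ L := by
  by_contra! hc
  obtain ⟨p, hpL, hpM⟩ := not_subset.1 hc.1
  obtain ⟨q, hqM, hqL⟩ := not_subset.1 hc.2
  have hinter : 0 ≤ gap x 1 (L ∩ Mᶜ) :=
    (hx.inCone hst).gap_nonneg _ ⟨p, by simp [hpL, hpM]⟩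
  have hcard : #((L ∪ Mᶜ) ∩ {s, t}) = 2 := by
    simp only [card_inter_pair hst, mem_union, mem_compl, hL.left_mem, hM.right_notMem]
    simp
  have hcut := hx.even_cut (L ∪ Mᶜ) ⟨p, by simp [hpL]⟩
    (ne_of_mem_of_not_mem' (mem_univ q) (by simp [hqL, hqM])).symm (hcard ▸ even_two)
  have hunion := hx.gap_eq hst (L ∪ Mᶜ)
  rw [hcard] at hunion
  push_cast at hunion
  linarith [gap_uncross x 1 L Mᶜ, weight_nonneg hx.nonneg (between (L \ Mᶜ) (Mᶜ \ L)),
    hx.gap_isNarrowSide hst hL, hx.gap_isNarrowSide hst hM, hL.weight_lt, hM.weight_lt]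

theorem IsFeasible.exists_isNarrowSide (hx : IsFeasible s t x) (hst : s ≠ t)
    (hC : C ∈ narrowCuts x) : ∃ L, IsNarrowSide s t x L ∧ C = cut L ∧ 1 ≤ weight x C := by
  obtain ⟨⟨U, hU, hU', rfl⟩, hlt⟩ := hC
  have hodd : Odd #(U ∩ {s, t}) :=
    Nat.not_even_iff_odd.1 fun h => (hx.even_cut U hU hU' h).not_gt hlt
  have hone := hx.odd_cut U hU hU' hodd
  rw [card_inter_pair hst] at hodd
  by_cases hs : s ∈ U <;> by_cases ht : t ∈ U
  · simp [hs, ht, Nat.odd_iff] at hodd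
  · exact ⟨U, ⟨hs, ht, hlt⟩, rfl, hone⟩
  · exact ⟨Uᶜ, ⟨by simpa, by simpa, by rwa [cut_compl]⟩, (cut_compl U).symm, hone⟩
  · simp [hs, ht, Nat.odd_iff] at hodd

theorem IsFeasible.exists_decomposition (hx : IsFeasible s t x) (hst : s ≠ t) :
    ∃ (r : ℕ) (S : Fin r → Finset (Edge V)) (p : Fin r → ℝ),
      (∀ j, IsSpanningTree (S j)) ∧ (∀ j, 0 < p j) ∧ ∑ j, p j = 1 ∧ x = ∑ j, p j • chi (S j) ∧
      ∀ C ∈ narrowCuts x, 1 ≤ weight x C ∧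
        ∀ j, ∑ i ∈ Iio j, p i < 2 - weight x C → #(C ∩ S j) = 1 := by
  classical
  have : Nontrivial V := ⟨s, t, hst⟩
  obtain ⟨r, S, p, hS, hp, hsum, hdec, hcut⟩ := (hx.inCone hst).exists_decomposition
    (𝓛 := univ.filter (IsNarrowSide s t x)) (θ := fun L => weight x (cut L) - 1)
    (fun L hL M hM => hx.subset_or_subset hst (mem_filter.1 hL).2 (mem_filter.1 hM).2)
    (fun L hL => ⟨⟨s, (mem_filter.1 hL).2.left_mem⟩,
      ⟨t, mem_compl.2 (mem_filter.1 hL).2.right_notMem⟩⟩)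
    (fun L hL _ => (hx.gap_isNarrowSide hst (mem_filter.1 hL).2).imp le_of_eq le_of_eq)
  refine ⟨r, S, p, hS, hp, hsum, hdec, fun C hC => ?_⟩
  obtain ⟨L, hL, rfl, hone⟩ := hx.exists_isNarrowSide hst hC
  refine ⟨hone, fun j hj => ?_⟩
  rw [inter_comm]
  exact hcut j L (by simp [hL]) (by linarith)

end Feasible

end PathTSP

theorem theorem3 {V : Type*} [Fintype V] [DecidableEq V] (s t : V) (hst : s ≠ t)
    (x : PathTSP.Edge V → ℝ) (hx : PathTSP.IsFeasible s t x) :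
    (∃ (r : ℕ) (S : Fin r → Finset (PathTSP.Edge V)) (p : Fin r → ℝ),
      (∀ j, PathTSP.IsSpanningTree (S j)) ∧
      (∀ j, 0 < p j) ∧
      ∑ j, p j = 1 ∧
      x = ∑ j, p j • PathTSP.chi (S j) ∧
      ∀ C ∈ PathTSP.narrowCuts x, ∃ k : Fin r,
        2 - PathTSP.weight x C ≤ ∑ j ∈ Finset.Iic k, p j ∧
        ∀ j ≤ k, (C ∩ S j).card = 1) ∧
    (∃ S : Finset (PathTSP.Edge V),
      PathTSP.IsGlobalGaoTree x S ∧ ∀ e ∈ S, 0 < x e) := by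
  obtain ⟨r, S, p, hS, hp, hsum, hdec, hcut⟩ := hx.exists_decomposition hst
  refine ⟨⟨r, S, p, hS, hp, hsum, hdec, fun C hC => ?_⟩, ?_⟩
  · obtain ⟨hone, hgao⟩ := hcut C hC
    have hle_one : 2 - PathTSP.weight x C ≤ ∑ j, p j := by linarith
    obtain ⟨k, hlt, hle⟩ := PathTSP.exists_sum_Iio_lt_le_sum_Iic (sub_pos.2 hC.2) hle_one
    exact ⟨k, hle, fun j hj => hgao j <| hlt.trans_le' <|
      Finset.sum_le_sum_of_subset_of_nonneg (Finset.Iio_subset_Iio hj) fun i _ _ => (hp i).le⟩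
  · have : NeZero r := ⟨by rintro rfl; simp at hsum⟩
    refine ⟨S 0, ⟨hS 0, fun C hC => ⟨hS 0, (hcut C hC).2 0 ?_⟩⟩, fun e he => ?_⟩
    · have hempty : Finset.Iio (0 : Fin r) = ∅ := by ext; simp
      rw [hempty, Finset.sum_empty]
      exact sub_pos.2 hC.2
    · rw [hdec]
      exact PathTSP.sum_smul_chi_pos (fun j => (hp j).le) (hp 0) he
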